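/- Let $\mathbb K=\mathbb R$ or $\mathbb C$ and $N=\{1,2,3\}$. For a tensor $\mathcal X\in\mathbb K^{n_1\times n_2\times n_3}$ consider the following linear maps to tensors of the same size. (a) For a set of modes $S\subseteq N$ and a matrix $\mathbf U$ of size $\prod_{i\in S}n_i$, $\mathcal X\,\bar\star_S\,\mathbf U=\mathrm{Fold}_S(\mathbf U\,\overline{\mathbf X}_{[S]})$, where $\overline{\mathbf X}_{[S]}$ is the unfolding of $\mathcal X$ into a $(\prod_{i\in S}n_i)\times(\prod_{j\notin S}n_j)$ matrix and $\mathrm{Fold}_S$ is the inverse of this unfolding. (b) For a mode $k$ and $\mathbf U\in\mathbb K^{n_k\times n_k}$, the mode-$k$ product $\mathcal X\times_k\mathbf U=\mathrm{Fold}_{(k)}(\mathbf U\mathbf X_{(k)})$, also written $\mathcal X\star_k\mathbf U$. (c) For an ordered pair of distinct modes $(k,p)$ and $\mathbf U\in\mathbb K^{n_k\times n_k}$, the face-wise product $\mathcal X\star_{(k,p)}\mathbf U$, which multiplies each $n_k\times n_p$ slice of $\mathcal X$ along the modes $(k,p)$ from the left by $\mathbf U$. Let $P$ be a finite ordered list of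 sets of modes $p\subseteq N$ and $Q$ a finite ordered list of single modes and ordered pairs of distinct modes $q$, each with a unitary (for $\mathbb K=\mathbb R$, orthogonal) factor $\mathbf U_p$, $\mathbf U_q$ of the appropriate size, and let $$\mathcal C(\mathcal X)=\mathcal X\,\bar\star_{p\in P}\mathbf U_p\,\star_{q\in Q}\mathbf U_q$$ be the composite transform (the factors are applied one after the other: those in $P$ in their order, then those in $Q$ in their order). Write $\mathbf C^{(i)}\in\mathbb K^{n_1\times n_2}$, $i=1,\dots,n_3$, for the frontal slices of $\mathcal C(\mathcal X)$, and set $$\|\mathcal X\|_{\mathrm{MT\text{-}TNN}}=\sum_{i=1}^{n_3}\|\mathbf C^{(i)}\|_*,\qquad r(\mathcal X)=\sum_{i=1}^{n_3}\operatorname{rank}\mathbf C^{(i)},\qquad B=\Big\{\mathcal X:\ \max_{1\le i\le n_3}\|\mathbf C^{(i)}\|_2\le 1\Big\},$$ where $\|\cdot\|_*$ is the nuclear norm and $\|\cdot\|_2$ the spectral norm of matrices. Thus $r$ is the $\ell_1$ norm of the transformed multi-rank, and $B$ the closed unit ball of the tensor spectral norm, both in the composite transformed domain. Then $\|\cdot\|_{\mathrm{MT\text{-}TNN}}$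 is the convex envelope of $r$ over $B$: it is convex on the convex set $B$, it satisfies $\|\mathcal X\|_{\mathrm{MT\text{-}TNN}}\le r(\mathcal X)$ for all $\mathcal X\in B$, and every convex function $h:B\to\mathbb R$ with $h\le r$ on $B$ satisfies $h\le\|\cdot\|_{\mathrm{MT\text{-}TNN}}$ on $B$. -/

import Mathlib

noncomputable section

namespace MTTNN

/-- Order-3 tensors of size `n 0 × n 1 × n 2`, as functions of a multi-index. -/
abbrev Tensor (𝕜 : Type*) (n : Fin 3 → ℕ) : Type _ := (∀ j, Fin (n j)) → 𝕜

variable {𝕜 : Type*} [RCLike 𝕜] {n : Fin 3 → ℕ}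

/-! ### The matricizing unfolding over a set of modes and the product `⋆̄` -/

/-- The multi-indices of the modes in `S`; there are `∏ i ∈ S, n i` of them. -/
abbrev RowIdx (n : Fin 3 → ℕ) (S : Finset (Fin 3)) : Type := ∀ j : {j // j ∈ S}, Fin (n j)

/-- The multi-indices of the modes outside `S`. -/
abbrev ColIdx (n : Fin 3 → ℕ) (S : Finset (Fin 3)) : Type := ∀ j : {j // ¬ j ∈ S}, Fin (n j)

/-- The unfolding of `X` into a `(∏ i ∈ S, n i) × (∏ i ∉ S, n i)` matrix. Rows and columns are
labelled by multi-indices, so that no particular order of vectorization has to be chosen. -/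
def unfold (S : Finset (Fin 3)) (X : Tensor 𝕜 n) : Matrix (RowIdx n S) (ColIdx n S) 𝕜 :=
  Matrix.of fun a b => X ((Equiv.piEquivPiSubtypeProd (· ∈ S) fun j => Fin (n j)).symm (a, b))

/-- The inverse of `unfold S`. -/
def fold (S : Finset (Fin 3)) (M : Matrix (RowIdx n S) (ColIdx n S) 𝕜) : Tensor 𝕜 n :=
  fun x => M (Equiv.piEquivPiSubtypeProd (· ∈ S) (fun j => Fin (n j)) x).1
    (Equiv.piEquivPiSubtypeProd (· ∈ S) (fun j => Fin (n j)) x).2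

/-- The product `X ⋆̄_S U`: the slices along the modes in `S` are vectorized and multiplied by
`U`. -/
def barStar (S : Finset (Fin 3)) (U : Matrix (RowIdx n S) (RowIdx n S) 𝕜) (X : Tensor 𝕜 n) :
    Tensor 𝕜 n :=
  fold S (U * unfold S X)

/-! ### The mode-`k` product -/

/-- The mode-`k` unfolding, an `n k × ∏ j ≠ k, n j` matrix. -/
def modeUnfold (k : Fin 3) (X : Tensor 𝕜 n) :
    Matrix (Fin (n k)) (∀ j : {j // j ≠ k}, Fin (n j)) 𝕜 :=
  Matrix.of fun a b => X ((Equiv.piSplitAt k fun j => Fin (n j)).symm (a, b))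

/-- The inverse of `modeUnfold k`. -/
def modeFold (k : Fin 3) (M : Matrix (Fin (n k)) (∀ j : {j // j ≠ k}, Fin (n j)) 𝕜) :
    Tensor 𝕜 n :=
  fun x => M (Equiv.piSplitAt k (fun j => Fin (n j)) x).1
    (Equiv.piSplitAt k (fun j => Fin (n j)) x).2

/-- The mode-`k` product `X ×_k U`. -/
def modeProd (k : Fin 3) (U : Matrix (Fin (n k)) (Fin (n k)) 𝕜) (X : Tensor 𝕜 n) : Tensor 𝕜 n :=
  modeFold k (U * modeUnfold k X)

/-! ### The face-wise product `⋆_{(k,p)}` -/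

/-- Splitting a multi-index into its entries in modes `k`, `p` and the remaining ones. -/
def splitPair {n : Fin 3 → ℕ} {k p : Fin 3} (h : k ≠ p) :
    (∀ j, Fin (n j)) ≃ Fin (n k) × Fin (n p) × ∀ j : {j // j ≠ k ∧ j ≠ p}, Fin (n j) where
  toFun x := (x k, x p, fun j => x j)
  invFun y j :=
    if hk : j = k then hk.symm ▸ y.1
    else if hp : j = p then hp.symm ▸ y.2.1
    else y.2.2 ⟨j, hk, hp⟩
  left_inv x := by grind
  right_inv y := by
    obtain ⟨a, b, c⟩ := y
    refine Prod.ext ?_ (Prod.ext ?_ (funext fun j => ?_))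
    · simp
    · simp [h.symm]
    · simp [j.2.1, j.2.2]

/-- The `i`-th `n k × n p` slice of the unfolding of `X` along the ordered pair `(k, p)`, where `i`
runs over the indices of the remaining mode. -/
def pairSlice {k p : Fin 3} (h : k ≠ p) (X : Tensor 𝕜 n)
    (i : ∀ j : {j // j ≠ k ∧ j ≠ p}, Fin (n j)) : Matrix (Fin (n k)) (Fin (n p)) 𝕜 :=
  Matrix.of fun a b => X ((splitPair h).symm (a, b, i))

/-- The face-wise product `X ⋆_{(k,p)} U`: the tensor whose `(k, p)`-slices are `U` times the
`(k, p)`-slices of `X`. -/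
def faceProd {k p : Fin 3} (h : k ≠ p) (U : Matrix (Fin (n k)) (Fin (n k)) 𝕜) (X : Tensor 𝕜 n) :
    Tensor 𝕜 n :=
  fun x => (U * pairSlice h X (splitPair h x).2.2) (splitPair h x).1 (splitPair h x).2.1

/-! ### The multimode transform -/

/-- A set `S` of modes with a unitary (for `𝕜 = ℝ`: orthogonal) factor for `⋆̄_S`. -/
structure BarFactor (𝕜 : Type*) [RCLike 𝕜] (n : Fin 3 → ℕ) where
  S : Finset (Fin 3)
  U : Matrix.unitaryGroup (RowIdx n S) 𝕜

/-- A mode `k`, or an ordered pair `(k, p)` of distinct modes, with a unitary (for `𝕜 = ℝ`: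
orthogonal) factor for `×_k` or `⋆_{(k,p)}`. -/
inductive StarFactor (𝕜 : Type*) [RCLike 𝕜] (n : Fin 3 → ℕ) where
  | single (k : Fin 3) (U : Matrix.unitaryGroup (Fin (n k)) 𝕜) : StarFactor 𝕜 n
  | pair (k p : Fin 3) (h : k ≠ p) (U : Matrix.unitaryGroup (Fin (n k)) 𝕜) : StarFactor 𝕜 n

/-- The product of a tensor with one factor of type `⋆̄`. -/
def BarFactor.act (F : BarFactor 𝕜 n) (X : Tensor 𝕜 n) : Tensor 𝕜 n := barStar F.S F.U X

/-- The product of a tensor with one factor of type `×` or `⋆`. -/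
def StarFactor.act : StarFactor 𝕜 n → Tensor 𝕜 n → Tensor 𝕜 n
  | .single k U, X => modeProd k U X
  | .pair _ _ h U, X => faceProd h U X

/-- The multimode nonlinear transform `ψ (X ⋆̄_{p ∈ P} U_p ⋆_{q ∈ Q} U_q)`: the factors in `P` are
applied first, in their order, then those in `Q`, then `ψ` elementwise. -/
def mnt (ψ : 𝕜 → 𝕜) (P : List (BarFactor 𝕜 n)) (Q : List (StarFactor 𝕜 n)) (X : Tensor 𝕜 n) :
    Tensor 𝕜 n :=
  fun x => ψ (Q.foldl (fun Y F => F.act Y) (P.foldl (fun Y F => F.act Y) X) x)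

/-- The multimode transform, without activation. -/
def mt (P : List (BarFactor 𝕜 n)) (Q : List (StarFactor 𝕜 n)) (X : Tensor 𝕜 n) : Tensor 𝕜 n :=
  mnt id P Q X

/-! ### Norms and ranks of frontal slices -/

/-- The `i`-th frontal slice `C(:, :, i)`. -/
def frontalSlice (C : Tensor 𝕜 n) (i : Fin (n 2)) : Matrix (Fin (n 0)) (Fin (n 1)) 𝕜 :=
  Matrix.of fun a b => C fun j => match j with
    | 0 => a
    | 1 => b
    | 2 => i

/-- The nuclear norm of a matrix, the sum of its singular values. -/
def nuclearNorm {a b : ℕ} (A : Matrix (Fin a) (Fin b) 𝕜) : ℝ :=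
  ∑ i ∈ Finset.range b, (Matrix.toEuclideanLin A).singularValues i

/-- The spectral norm of a matrix, its operator norm for the Euclidean norms. -/
def spectralNorm {a b : ℕ} (A : Matrix (Fin a) (Fin b) 𝕜) : ℝ :=
  ‖(Matrix.toEuclideanLin A).toContinuousLinearMap‖

/-- The norm `∑ i, ‖C⁽ⁱ⁾‖_*` of the transformed tensor `C = mnt ψ P Q X`. -/
def mntTNN (ψ : 𝕜 → 𝕜) (P : List (BarFactor 𝕜 n)) (Q : List (StarFactor 𝕜 n))
    (X : Tensor 𝕜 n) : ℝ :=
  ∑ i, nuclearNorm (frontalSlice (mnt ψ P Q X) i)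

/-- MT-TNN, the norm `mntTNN` without activation. -/
def mtTNN (P : List (BarFactor 𝕜 n)) (Q : List (StarFactor 𝕜 n)) (X : Tensor 𝕜 n) : ℝ :=
  mntTNN id P Q X

/-- The transformed multi-rank: the vector of ranks of the frontal slices of the transformed
tensor. -/
def multiRank (P : List (BarFactor 𝕜 n)) (Q : List (StarFactor 𝕜 n)) (X : Tensor 𝕜 n) :
    Fin (n 2) → ℕ :=
  fun i => (frontalSlice (mt P Q X) i).rank

/-- The `ℓ₁` norm of the transformed multi-rank. -/
def multiRankL1 (P : List (BarFactor 𝕜 n)) (Q : List (StarFactor 𝕜 n)) (X : Tensor 𝕜 n) : ℝ :=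
  ∑ i, |(multiRank P Q X i : ℝ)|

/-- The tensor spectral norm in the transformed domain: the largest spectral norm of a frontal
slice of the transformed tensor. -/
def tensorSpectralNorm (P : List (BarFactor 𝕜 n)) (Q : List (StarFactor 𝕜 n)) (X : Tensor 𝕜 n) :
    ℝ :=
  ⨆ i, spectralNorm (frontalSlice (mt P Q X) i)

/-- The closed unit ball of the tensor spectral norm. -/
def spectralBall (P : List (BarFactor 𝕜 n)) (Q : List (StarFactor 𝕜 n)) : Set (Tensor 𝕜 n) :=
  {X | tensorSpectralNorm P Q X ≤ 1}

/-- `g` is the convex envelope of `f` over the convex set `s`: the pointwise largest convex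
function on `s` that lies below `f` on `s`. -/
structure IsConvexEnvelopeOn {E : Type*} [AddCommGroup E] [Module ℝ E] (s : Set E)
    (f g : E → ℝ) : Prop where
  convexOn : ConvexOn ℝ s g
  le : ∀ x ∈ s, g x ≤ f x
  greatest : ∀ h : E → ℝ, ConvexOn ℝ s h → (∀ x ∈ s, h x ≤ f x) → ∀ x ∈ s, h x ≤ g x

end MTTNN

end

/-! The composite transform is a linear bijection, since each factor is multiplication by an
invertible matrix after a relabelling of indices. It therefore suffices to prove the envelope
property for tuples of operators, with the sum of nuclear norms, the sum of ranks and the product of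
operator-norm unit balls (`isConvexEnvelopeOn_sum_opNuclearNorm`).

Convexity comes from trace duality: the nuclear norm of `T` is the maximum of `Re tr (W* T)` over
contractions `W` (`sum_inner_le_opNuclearNorm`, `exists_sum_inner_eq_opNuclearNorm`). On the ball
all singular values are at most 1, and only as many as the rank are nonzero, so the nuclear norm is
at most the rank.

For maximality no biconjugate is computed. The singular vectors of every component of `x` are kept
and the singular values are replaced by parameters `t` in the unit cube. This gives a linear map `D`
from the cube into the ball with `D σ = x`. The function `h (D t) - ∑ t` is convex, hence bounded at
`σ` by its value at some vertex; at a vertex the total rank of `D t` is at most `∑ t`, so this value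
is nonpositive. Thus `h x ≤ ∑ σ`. -/

namespace MTTNN

set_option linter.unusedSectionVars false

/-! ### Singular values, trace duality and rank of operators. -/

section Operators

open Module

variable {𝕜 : Type*} [RCLike 𝕜]
  {E : Type*} [NormedAddCommGroup E] [InnerProductSpace 𝕜 E] [FiniteDimensional 𝕜 E]
  {F : Type*} [NormedAddCommGroup F] [InnerProductSpace 𝕜 F] [FiniteDimensional 𝕜 F]

/-- The sum of the singular values of an operator. -/
noncomputable def opNuclearNorm (T : E →ₗ[𝕜] F) : ℝ :=
  ∑ i : Fin (finrank 𝕜 E), T.singularValues i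

theorem norm_sq_sum_of_pairwise_inner_eq_zero {G m : Type*} [NormedAddCommGroup G]
    [InnerProductSpace 𝕜 G] [Fintype m] {f : m → G}
    (hf : ∀ i j, i ≠ j → inner 𝕜 (f i) (f j) = 0) : ‖∑ j, f j‖ ^ 2 = ∑ j, ‖f j‖ ^ 2 := by
  classical
  have h : inner 𝕜 (∑ j, f j) (∑ j, f j) = ∑ j, (‖f j‖ : 𝕜) ^ 2 := by
    rw [sum_inner]
    refine Finset.sum_congr rfl fun i _ => ?_
    rw [inner_sum, Finset.sum_eq_single i (fun j _ hj => hf i j hj.symm) (by simp),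
      inner_self_eq_norm_sq_to_K]
  rw [inner_self_eq_norm_sq_to_K] at h
  exact_mod_cast h

/-- A singular value decomposition: the right singular vectors form an orthonormal basis, the left
singular vectors are orthogonal, of norm one where the singular value is nonzero. -/
theorem exists_singularValueDecomposition (T : E →ₗ[𝕜] F) :
    ∃ (v : OrthonormalBasis (Fin (finrank 𝕜 E)) 𝕜 E) (u : Fin (finrank 𝕜 E) → F),
      (Pairwise fun i j => inner 𝕜 (u i) (u j) = 0) ∧ (∀ j, ‖u j‖ ≤ 1) ∧
      (∀ j, T (v j) = (T.singularValues j : 𝕜) • u j) ∧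
      ∀ j : Fin (finrank 𝕜 E), T.singularValues j ≠ 0 → ‖u j‖ = 1 := by
  set hT := T.isSymmetric_adjoint_comp_self
  set v := hT.eigenvectorBasis rfl
  -- The `v j` are eigenvectors of `T* T`, so their images under `T` have a diagonal Gram matrix.
  have key : ∀ i j, inner 𝕜 (T (v i)) (T (v j)) =
      if i = j then ((T.singularValues j : 𝕜)) ^ 2 else 0 := by
    intro i j
    rw [← LinearMap.adjoint_inner_right, ← LinearMap.comp_apply, hT.apply_eigenvectorBasis rfl j,
      inner_smul_right, ← T.sq_singularValues_fin rfl j,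
      orthonormal_iff_ite.mp v.orthonormal i j]
    split_ifs <;> simp
  have hnorm : ∀ j : Fin (finrank 𝕜 E), ‖T (v j)‖ = T.singularValues j := by
    intro j
    have h := key j j
    rw [inner_self_eq_norm_sq_to_K, if_pos rfl] at h
    have h' : ‖T (v j)‖ ^ 2 = T.singularValues j ^ 2 := by exact_mod_cast h
    exact (sq_eq_sq₀ (norm_nonneg _) (T.singularValues_nonneg j)).mp h'
  have hu : ∀ j : Fin (finrank 𝕜 E), T.singularValues j ≠ 0 →
      ‖((T.singularValues j : 𝕜)⁻¹) • T (v j)‖ = 1 := by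
    intro j hj
    rw [norm_smul, hnorm, norm_inv, RCLike.norm_ofReal, abs_of_nonneg (T.singularValues_nonneg j),
      inv_mul_cancel₀ hj]
  -- As `0⁻¹ = 0`, the left vector is zero where the singular value vanishes. An orthonormal choice
  -- need not exist, because `F` may have smaller dimension than `E`.
  refine ⟨v, fun j => ((T.singularValues j : 𝕜)⁻¹) • T (v j), ?_, ?_, ?_, hu⟩
  · intro i j hij
    simp [inner_smul_left, inner_smul_right, key i j, hij]
  · intro j
    by_cases hj : T.singularValues j = 0
    · simp [hj]
    · exact (hu j hj).le
  · intro j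
    by_cases hj : T.singularValues j = 0
    · have : T (v j) = 0 := norm_eq_zero.mp ((hnorm j).trans hj)
      simp [this]
    · rw [smul_inv_smul₀]
      exact_mod_cast hj

/-- The left side is the real part of the trace of `W* T`, hence independent of the basis. In a
basis of right singular vectors, Cauchy–Schwarz bounds each term by a singular value. -/
theorem sum_inner_le_opNuclearNorm {m : Type*} [Fintype m] (e : OrthonormalBasis m 𝕜 E)
    (T W : E →ₗ[𝕜] F) (hW : ∀ x, ‖W x‖ ≤ ‖x‖) :
    ∑ j, RCLike.re (inner 𝕜 (W (e j)) (T (e j))) ≤ opNuclearNorm T := by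
  obtain ⟨v, u, -, hu1, hT, -⟩ := exists_singularValueDecomposition T
  have htr : ∑ j, inner 𝕜 (W (e j)) (T (e j)) = ∑ j, inner 𝕜 (W (v j)) (T (v j)) := by
    have h1 := LinearMap.trace_eq_sum_inner (W.adjoint ∘ₗ T) e
    have h2 := LinearMap.trace_eq_sum_inner (W.adjoint ∘ₗ T) v
    simp only [LinearMap.comp_apply, LinearMap.adjoint_inner_right] at h1 h2
    rw [← h1, h2]
  rw [← map_sum, htr, map_sum]
  refine Finset.sum_le_sum fun j _ => ?_
  rw [hT, inner_smul_right, RCLike.re_ofReal_mul]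
  refine mul_le_of_le_one_right (T.singularValues_nonneg j) ?_
  calc _ ≤ ‖W (v j)‖ * ‖u j‖ := (RCLike.re_le_norm _).trans (norm_inner_le_norm _ _)
    _ ≤ 1 * 1 := by
      gcongr
      · exact (hW _).trans (v.norm_eq_one j).le
      · exact hu1 j
    _ = 1 := one_mul 1

theorem singularValues_le_one {T : E →ₗ[𝕜] F} (hT : ∀ x, ‖T x‖ ≤ ‖x‖)
    (j : Fin (finrank 𝕜 E)) : T.singularValues j ≤ 1 := by
  obtain ⟨v, u, -, -, h, hn⟩ := exists_singularValueDecomposition T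
  by_cases hj : T.singularValues j = 0
  · simp [hj]
  · have := hT (v j)
    rwa [h, norm_smul, hn j hj, v.norm_eq_one, mul_one, RCLike.norm_ofReal,
      abs_of_nonneg (T.singularValues_nonneg j)] at this

theorem opNuclearNorm_le_finrank_range {T : E →ₗ[𝕜] F} (hT : ∀ x, ‖T x‖ ≤ ‖x‖) :
    opNuclearNorm T ≤ finrank 𝕜 (LinearMap.range T) := by
  -- Singular values are listed in decreasing order, so those with index at least the rank vanish.
  have h : ∀ j : Fin (finrank 𝕜 E), T.singularValues j ≤
      if (j : ℕ) < finrank 𝕜 (LinearMap.range T) then 1 else 0 := by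
    intro j
    split_ifs with hj
    · exact singularValues_le_one hT j
    · exact (T.singularValues_eq_zero_iff_le_finrank_range.mpr (not_lt.mp hj)).le
  refine (Finset.sum_le_sum fun j _ => h j).trans ?_
  rw [Fin.sum_univ_eq_sum_range (fun j => if j < finrank 𝕜 (LinearMap.range T) then (1 : ℝ) else 0),
    Finset.sum_ite, Finset.sum_const_zero, add_zero, Finset.sum_const, nsmul_one]
  have : (Finset.range (finrank 𝕜 E)).filter (· < finrank 𝕜 (LinearMap.range T)) ⊆
      Finset.range (finrank 𝕜 (LinearMap.range T)) := fun i => by simp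
  exact_mod_cast (Finset.card_le_card this).trans (Finset.card_range _).le

/-! ### Operators with prescribed singular vectors, and the convex envelope. -/

variable [NormedSpace ℝ F] [IsScalarTower ℝ 𝕜 F]

/-- The operator with right singular vectors `v`, left singular vectors `u` and real
coefficients `t`. -/
noncomputable def diagMap {m : Type*} [Fintype m] (v : OrthonormalBasis m 𝕜 E) (u : m → F) :
    (m → ℝ) →ₗ[ℝ] (E →ₗ[𝕜] F) where
  toFun t := v.toBasis.constr 𝕜 fun j => (t j : 𝕜) • u j
  map_add' s t := v.toBasis.ext fun j => by
    simp only [Basis.constr_basis, LinearMap.add_apply, Pi.add_apply, RCLike.ofReal_add, add_smul]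
  map_smul' c t := v.toBasis.ext fun j => by
    simp only [Basis.constr_basis, LinearMap.smul_apply, Pi.smul_apply, smul_eq_mul,
      RingHom.id_apply, RCLike.ofReal_mul, mul_smul]
    rw [RCLike.real_smul_eq_coe_smul (K := 𝕜)]

section diagMap

variable {m : Type*} [Fintype m] (v : OrthonormalBasis m 𝕜 E) (u : m → F)

@[simp]
theorem diagMap_apply_basis (t : m → ℝ) (j : m) : diagMap v u t (v j) = (t j : 𝕜) • u j := by
  have h := v.toBasis.constr_basis 𝕜 (fun j => (t j : 𝕜) • u j) j
  rwa [v.coe_toBasis] at h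

theorem diagMap_apply (t : m → ℝ) (x : E) :
    diagMap v u t x = ∑ j, inner 𝕜 (v j) x • (t j : 𝕜) • u j := by
  conv_lhs => rw [← v.sum_repr' x]
  simp

variable {v u}

theorem norm_diagMap_apply_le (hu : Pairwise fun i j => inner 𝕜 (u i) (u j) = 0)
    (hu1 : ∀ j, ‖u j‖ ≤ 1) {t : m → ℝ} (ht : ∀ j, |t j| ≤ 1) (x : E) :
    ‖diagMap v u t x‖ ≤ ‖x‖ := by
  classical
  refine le_of_sq_le_sq ?_ (norm_nonneg _)
  rw [diagMap_apply, ← v.sum_sq_norm_inner_right x]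
  have horth : ∀ i j, i ≠ j → inner 𝕜 (inner 𝕜 (v i) x • (t i : 𝕜) • u i)
      (inner 𝕜 (v j) x • (t j : 𝕜) • u j) = 0 := fun i j hij => by
    simp only [inner_smul_left, inner_smul_right, hu hij, mul_zero]
  rw [norm_sq_sum_of_pairwise_inner_eq_zero horth]
  refine Finset.sum_le_sum fun j _ => ?_
  gcongr
  rw [norm_smul, norm_smul, RCLike.norm_ofReal]
  exact mul_le_of_le_one_right (norm_nonneg _) (mul_le_one₀ (ht j) (norm_nonneg _) (hu1 j))

/-- The range is spanned by the `u j` with `t j = 1`, and there are `∑ j, t j` such indices. Some `u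
j` may be zero, whence only an inequality. -/
theorem finrank_range_diagMap_le {t : m → ℝ} (ht : ∀ j, t j = 0 ∨ t j = 1) :
    (finrank 𝕜 (LinearMap.range (diagMap v u t)) : ℝ) ≤ ∑ j, t j := by
  classical
  have hle : LinearMap.range (diagMap v u t) ≤
      Submodule.span 𝕜 (((Finset.univ.filter fun j => t j = 1).image u : Finset F) : Set F) := by
    rintro _ ⟨x, rfl⟩
    rw [diagMap_apply]
    refine Submodule.sum_mem _ fun j _ => Submodule.smul_mem _ _ ?_
    rcases ht j with h | h
    · simp [h]
    · refine Submodule.smul_mem _ _ (Submodule.subset_span ?_)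
      simpa using ⟨j, h, rfl⟩
  have hcard : (((Finset.univ.filter fun j => t j = 1).card : ℕ) : ℝ) = ∑ j, t j := by
    rw [Finset.card_filter]
    push_cast
    refine Finset.sum_congr rfl fun j _ => ?_
    rcases ht j with h | h <;> simp [h]
  rw [← hcard]
  exact_mod_cast (Submodule.finrank_mono hle).trans
    ((finrank_span_finset_le_card _).trans Finset.card_image_le)

end diagMap

theorem exists_sum_inner_eq_opNuclearNorm (T : E →ₗ[𝕜] F) :
    ∃ (W : E →ₗ[𝕜] F) (v : OrthonormalBasis (Fin (finrank 𝕜 E)) 𝕜 E), (∀ x, ‖W x‖ ≤ ‖x‖) ∧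
      ∑ j, RCLike.re (inner 𝕜 (W (v j)) (T (v j))) = opNuclearNorm T := by
  obtain ⟨v, u, hu, hu1, hT, hn⟩ := exists_singularValueDecomposition T
  -- The maximizer is the partial isometry sending each `v j` to `u j`.
  refine ⟨diagMap v u 1, v, norm_diagMap_apply_le hu hu1 (by simp), ?_⟩
  refine Finset.sum_congr rfl fun j _ => ?_
  rw [diagMap_apply_basis, hT, inner_smul_right, RCLike.re_ofReal_mul]
  by_cases hj : T.singularValues j = 0
  · simp [hj]
  · simp [hn j hj]

/-- A contraction `W` optimal for the combination is a competitor for both `S` and `T`, and the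
pairing with a fixed `W` is real-linear. -/
theorem opNuclearNorm_convex (S T : E →ₗ[𝕜] F) {a b : ℝ} (ha : 0 ≤ a) (hb : 0 ≤ b) :
    opNuclearNorm (a • S + b • T) ≤ a * opNuclearNorm S + b * opNuclearNorm T := by
  obtain ⟨W, v, hW, h⟩ := exists_sum_inner_eq_opNuclearNorm (a • S + b • T)
  rw [← h]
  have hs := mul_le_mul_of_nonneg_left (sum_inner_le_opNuclearNorm v S W hW) ha
  have ht := mul_le_mul_of_nonneg_left (sum_inner_le_opNuclearNorm v T W hW) hb
  refine le_trans (le_of_eq ?_) (add_le_add hs ht)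
  simp only [Finset.mul_sum, ← Finset.sum_add_distrib]
  refine Finset.sum_congr rfl fun j _ => ?_
  simp only [LinearMap.add_apply, LinearMap.smul_apply, inner_add_right, map_add,
    RCLike.real_smul_eq_coe_smul (K := 𝕜), inner_smul_right, RCLike.re_ofReal_mul]

theorem convexHull_boolean_cube {ι : Type*} [Finite ι] :
    convexHull ℝ {t : ι → ℝ | ∀ i, t i = 0 ∨ t i = 1} = Set.Icc 0 1 := by
  have h : {t : ι → ℝ | ∀ i, t i = 0 ∨ t i = 1} = Set.univ.pi fun _ => {0, 1} := by
    ext t; simp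
  rw [h, convexHull_pi, ← Set.pi_univ_Icc]
  simp [convexHull_pair, segment_eq_Icc]

/-- The sum of nuclear norms is the convex envelope of the sum of ranks over the product of the
unit balls of the operator norm, for a space identified with a space of tuples of operators. -/
theorem isConvexEnvelopeOn_sum_opNuclearNorm {ι X : Type*} [Fintype ι] [AddCommGroup X]
    [Module ℝ X] (Φ : X ≃ₗ[ℝ] (ι → E →ₗ[𝕜] F)) :
    IsConvexEnvelopeOn {x | ∀ i y, ‖Φ x i y‖ ≤ ‖y‖}
      (fun x => ∑ i, (finrank 𝕜 (LinearMap.range (Φ x i)) : ℝ))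
      (fun x => ∑ i, opNuclearNorm (Φ x i)) where
  convexOn := by
    refine ⟨?_, ?_⟩
    · intro x hx y hy a b ha hb hab i z
      simp only [map_add, map_smul, Pi.add_apply, Pi.smul_apply, LinearMap.add_apply,
        LinearMap.smul_apply, RCLike.real_smul_eq_coe_smul (K := 𝕜)]
      calc _ ≤ a * ‖Φ x i z‖ + b * ‖Φ y i z‖ := by
            refine (norm_add_le _ _).trans (le_of_eq ?_)
            simp [norm_smul, abs_of_nonneg, ha, hb]
        _ ≤ a * ‖z‖ + b * ‖z‖ := by gcongr; exacts [hx i z, hy i z]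
        _ = ‖z‖ := by rw [← add_mul, hab, one_mul]
    · intro x _ y _ a b ha hb _
      simp only [smul_eq_mul, Finset.mul_sum, ← Finset.sum_add_distrib]
      refine Finset.sum_le_sum fun i _ => ?_
      simpa using opNuclearNorm_convex (Φ x i) (Φ y i) ha hb
  le x hx := Finset.sum_le_sum fun i _ => opNuclearNorm_le_finrank_range (hx i)
  greatest h hconv hle x hx := by
    choose v u hu hu1 hT _ using fun i => exists_singularValueDecomposition (Φ x i)
    -- One real parameter for each component and each singular direction, so that all components
    -- vary at once.
    let D : (ι × Fin (finrank 𝕜 E) → ℝ) →ₗ[ℝ] X := Φ.symm.toLinearMap ∘ₗ LinearMap.pi fun i =>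
      diagMap (v i) (u i) ∘ₗ LinearMap.funLeft ℝ ℝ (Prod.mk i)
    have hD : ∀ t i, Φ (D t) i = diagMap (v i) (u i) fun j => t (i, j) := by
      intro t i
      simp only [D, LinearMap.comp_apply, LinearEquiv.coe_coe, LinearEquiv.apply_symm_apply]
      rfl
    let σ : ι × Fin (finrank 𝕜 E) → ℝ := fun p => (Φ x p.1).singularValues p.2
    have hσ : D σ = x := by
      refine Φ.injective (funext fun i => (v i).toBasis.ext fun j => ?_)
      rw [hD]
      simp [hT, σ]
    have hmaps : ∀ t ∈ Set.Icc (0 : ι × Fin (finrank 𝕜 E) → ℝ) 1,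
        D t ∈ {x | ∀ i y, ‖Φ x i y‖ ≤ ‖y‖} := by
      intro t ht i y
      rw [hD]
      refine norm_diagMap_apply_le (hu i) (hu1 i) (fun j => ?_) y
      rw [abs_of_nonneg (ht.1 _)]
      exact ht.2 _
    have hconv' : ConvexOn ℝ (Set.Icc (0 : ι × Fin (finrank 𝕜 E) → ℝ) 1)
        (fun t => h (D t) - ∑ p, t p) := by
      refine ConvexOn.sub ((hconv.comp_linearMap D).subset hmaps (convex_Icc 0 1)) ?_
      refine ⟨convex_Icc 0 1, fun s _ t _ a b _ _ _ => le_of_eq ?_⟩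
      simp [Finset.mul_sum, Finset.sum_add_distrib]
    have hσ1 : σ ∈ Set.Icc (0 : ι × Fin (finrank 𝕜 E) → ℝ) 1 :=
      ⟨fun p => (Φ x p.1).singularValues_nonneg _, fun p => singularValues_le_one (hx p.1) p.2⟩
    have hvert := convexHull_boolean_cube (ι := ι × Fin (finrank 𝕜 E))
    -- Maximum principle: the cube is the convex hull of its vertices, so some vertex `t` gives a
    -- value at least that at `σ`.
    obtain ⟨t, ht, hσt⟩ := hconv'.exists_ge_of_mem_convexHull
      (hvert ▸ subset_convexHull ℝ _) (hvert ▸ hσ1)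
    have hr := hle (D t) (hmaps t (hvert ▸ subset_convexHull ℝ _ ht))
    have hrank : ∑ i, (finrank 𝕜 (LinearMap.range (Φ (D t) i)) : ℝ) ≤ ∑ p, t p := by
      rw [Fintype.sum_prod_type]
      refine Finset.sum_le_sum fun i _ => ?_
      rw [hD]
      exact finrank_range_diagMap_le fun j => ht (i, j)
    have hsum : ∑ p, σ p = ∑ i, opNuclearNorm (Φ x i) := Fintype.sum_prod_type _
    rw [hσ, hsum] at hσt
    linarith

end Operators

end MTTNN
namespace MTTNN

set_option linter.unusedSectionVars false

/-! ### Invertibility of the transform, and translation from matrices to operators. -/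

section Transform

open Module

variable {𝕜 : Type*} [RCLike 𝕜] {n : Fin 3 → ℕ}

/-- A family of left multiplications, compatible with products, as a family of linear
automorphisms. -/
def actEquiv {m V : Type*} [Fintype m] [DecidableEq m] [AddCommGroup V] [Module 𝕜 V]
    (f : Matrix m m 𝕜 → V → V) (hadd : ∀ U x y, f U (x + y) = f U x + f U y)
    (hsmul : ∀ U (c : 𝕜) x, f U (c • x) = c • f U x)
    (hmul : ∀ U U' x, f U (f U' x) = f (U * U') x) (hone : ∀ x, f 1 x = x)
    (U : Matrix.unitaryGroup m 𝕜) : V ≃ₗ[𝕜] V where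
  toFun := f U
  invFun := f (star U : Matrix m m 𝕜)
  map_add' := hadd U
  map_smul' := hsmul U
  left_inv x := by rw [hmul, Unitary.coe_star_mul_self, hone]
  right_inv x := by rw [hmul, (Unitary.mem_iff.mp U.2).2, hone]

theorem unfold_fold (S : Finset (Fin 3)) (M : Matrix (RowIdx n S) (ColIdx n S) 𝕜) :
    unfold S (fold S M) = M := by
  ext a b
  simp only [unfold, fold, Matrix.of_apply, Equiv.apply_symm_apply]

theorem fold_unfold (S : Finset (Fin 3)) (X : Tensor 𝕜 n) : fold S (unfold S X) = X := by
  ext x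
  simp only [unfold, fold, Matrix.of_apply, Prod.mk.eta, Equiv.symm_apply_apply]

theorem modeUnfold_modeFold (k : Fin 3)
    (M : Matrix (Fin (n k)) (∀ j : {j // j ≠ k}, Fin (n j)) 𝕜) :
    modeUnfold k (modeFold k M) = M := by
  ext a b
  simp only [modeUnfold, modeFold, Matrix.of_apply, Equiv.apply_symm_apply]

theorem modeFold_modeUnfold (k : Fin 3) (X : Tensor 𝕜 n) : modeFold k (modeUnfold k X) = X := by
  ext x
  simp only [modeUnfold, modeFold, Matrix.of_apply, Prod.mk.eta, Equiv.symm_apply_apply]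

theorem pairSlice_faceProd {k p : Fin 3} (h : k ≠ p) (U : Matrix (Fin (n k)) (Fin (n k)) 𝕜)
    (X : Tensor 𝕜 n) (i : ∀ j : {j // j ≠ k ∧ j ≠ p}, Fin (n j)) :
    pairSlice h (faceProd h U X) i = U * pairSlice h X i := by
  ext a b
  rw [pairSlice, Matrix.of_apply, faceProd, Equiv.apply_symm_apply]

/-- Unitarity serves only to provide an inverse; no isometry property of the transform is needed. -/
theorem BarFactor.exists_linearEquiv (F : BarFactor 𝕜 n) :
    ∃ L : Tensor 𝕜 n ≃ₗ[𝕜] Tensor 𝕜 n, ∀ X, F.act X = L X := by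
  refine ⟨actEquiv (barStar F.S) (fun U x y => ?_) (fun U c x => ?_) (fun U U' x => ?_)
    (fun x => ?_) F.U, fun X => rfl⟩
  · exact congrArg (fold F.S) (Matrix.mul_add U (unfold F.S x) (unfold F.S y))
  · exact congrArg (fold F.S) (Matrix.mul_smul U c (unfold F.S x))
  · rw [barStar, barStar, unfold_fold, ← Matrix.mul_assoc, barStar]
  · rw [barStar, Matrix.one_mul, fold_unfold]

theorem StarFactor.exists_linearEquiv (F : StarFactor 𝕜 n) :
    ∃ L : Tensor 𝕜 n ≃ₗ[𝕜] Tensor 𝕜 n, ∀ X, F.act X = L X := by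
  rcases F with ⟨k, U⟩ | ⟨k, p, h, U⟩
  · refine ⟨actEquiv (modeProd k) (fun U x y => ?_) (fun U c x => ?_) (fun U U' x => ?_)
      (fun x => ?_) U, fun X => rfl⟩
    · exact congrArg (modeFold k) (Matrix.mul_add U (modeUnfold k x) (modeUnfold k y))
    · exact congrArg (modeFold k) (Matrix.mul_smul U c (modeUnfold k x))
    · rw [modeProd, modeProd, modeUnfold_modeFold, ← Matrix.mul_assoc, modeProd]
    · rw [modeProd, Matrix.one_mul, modeFold_modeUnfold]
  · refine ⟨actEquiv (faceProd h) (fun U x y => ?_) (fun U c x => ?_) (fun U U' x => ?_)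
      (fun x => ?_) U, fun X => rfl⟩
    · funext z
      exact congrFun₂ (Matrix.mul_add U (pairSlice h x _) (pairSlice h y _)) _ _
    · funext z
      exact congrFun₂ (Matrix.mul_smul U c (pairSlice h x _)) _ _
    · funext z
      rw [faceProd, pairSlice_faceProd, ← Matrix.mul_assoc, faceProd]
    · funext z
      rw [faceProd, Matrix.one_mul, pairSlice, Matrix.of_apply]
      exact congrArg x ((splitPair h).symm_apply_apply z)

theorem exists_linearEquiv_foldl {V α : Type*} [AddCommGroup V] [Module 𝕜 V] (f : V → α → V)
    (hf : ∀ a, ∃ L : V ≃ₗ[𝕜] V, ∀ x, f x a = L x) (l : List α) :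
    ∃ L : V ≃ₗ[𝕜] V, ∀ x, l.foldl f x = L x := by
  induction l with
  | nil => exact ⟨LinearEquiv.refl 𝕜 V, fun x => rfl⟩
  | cons a l ih =>
    obtain ⟨L, hL⟩ := ih
    obtain ⟨M, hM⟩ := hf a
    exact ⟨M.trans L, fun x => by rw [List.foldl_cons, hL, hM]; rfl⟩

theorem exists_linearEquiv_mt (P : List (BarFactor 𝕜 n)) (Q : List (StarFactor 𝕜 n)) :
    ∃ L : Tensor 𝕜 n ≃ₗ[𝕜] Tensor 𝕜 n, ∀ X, mt P Q X = L X := by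
  obtain ⟨L, hL⟩ := exists_linearEquiv_foldl (fun (Y : Tensor 𝕜 n) F => BarFactor.act F Y)
    (fun F => F.exists_linearEquiv) P
  obtain ⟨M, hM⟩ := exists_linearEquiv_foldl (fun (Y : Tensor 𝕜 n) F => StarFactor.act F Y)
    (fun F => F.exists_linearEquiv) Q
  refine ⟨L.trans M, fun X => ?_⟩
  rw [LinearEquiv.trans_apply, ← hL, ← hM]
  rfl

/-- The identification of a tensor with the tuple of its frontal slices. -/
def frontalSliceEquiv : Tensor 𝕜 n ≃ₗ[𝕜] (Fin (n 2) → Matrix (Fin (n 0)) (Fin (n 1)) 𝕜) where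
  toFun := frontalSlice
  invFun M x := M (x 2) (x 0) (x 1)
  map_add' _ _ := rfl
  map_smul' _ _ := rfl
  left_inv X := by
    funext x
    refine congrArg X (funext fun j => ?_)
    fin_cases j <;> rfl
  right_inv M := rfl

theorem nuclearNorm_eq_opNuclearNorm {a b : ℕ} (A : Matrix (Fin a) (Fin b) 𝕜) :
    nuclearNorm A = opNuclearNorm (Matrix.toEuclideanLin A) := by
  rw [nuclearNorm, opNuclearNorm,
    Fin.sum_univ_eq_sum_range (fun i => (Matrix.toEuclideanLin A).singularValues i),
    finrank_euclideanSpace_fin]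

theorem rank_eq_finrank_range_toEuclideanLin {a b : ℕ} (A : Matrix (Fin a) (Fin b) 𝕜) :
    A.rank = finrank 𝕜 (LinearMap.range (Matrix.toEuclideanLin A)) := by
  rw [Matrix.toEuclideanLin, Matrix.toLpLin_eq_toLin]
  exact A.rank_eq_finrank_range_toLin _ _

theorem spectralNorm_le_one_iff {a b : ℕ} (A : Matrix (Fin a) (Fin b) 𝕜) :
    spectralNorm A ≤ 1 ↔ ∀ x, ‖Matrix.toEuclideanLin A x‖ ≤ ‖x‖ := by
  rw [spectralNorm, ContinuousLinearMap.opNorm_le_iff zero_le_one]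
  simp

theorem mem_spectralBall_iff (P : List (BarFactor 𝕜 n)) (Q : List (StarFactor 𝕜 n))
    (X : Tensor 𝕜 n) :
    X ∈ spectralBall P Q ↔ ∀ i, spectralNorm (frontalSlice (mt P Q X) i) ≤ 1 := by
  rw [spectralBall, Set.mem_ofPred_eq, tensorSpectralNorm]
  -- If there are no frontal slices, the real supremum is `0` by convention; `zero_le_one` covers
  -- this case.
  exact ⟨fun h i => (le_ciSup (Set.finite_range _).bddAbove i).trans h,
    fun h => Real.iSup_le h zero_le_one⟩

end Transform

end MTTNN

theorem mainTheorem2 {𝕜 : Type*} [RCLike 𝕜] (n : Fin 3 → ℕ)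
    (P : List (MTTNN.BarFactor 𝕜 n)) (Q : List (MTTNN.StarFactor 𝕜 n)) :
    MTTNN.IsConvexEnvelopeOn (MTTNN.spectralBall P Q)
      (MTTNN.multiRankL1 P Q) (MTTNN.mtTNN P Q) := by
  obtain ⟨L, hL⟩ := MTTNN.exists_linearEquiv_mt P Q
  -- Scalars are restricted to `ℝ` because convexity is real, while the operators and their ranks
  -- remain over `𝕜`.
  let Φ : MTTNN.Tensor 𝕜 n ≃ₗ[ℝ]
      (Fin (n 2) → EuclideanSpace 𝕜 (Fin (n 1)) →ₗ[𝕜] EuclideanSpace 𝕜 (Fin (n 0))) :=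
    (L.trans (MTTNN.frontalSliceEquiv.trans
      (LinearEquiv.piCongrRight fun _ => Matrix.toEuclideanLin))).restrictScalars ℝ
  have hΦ : ∀ X i, Φ X i = Matrix.toEuclideanLin (MTTNN.frontalSlice (MTTNN.mt P Q X) i) :=
    fun X i => by rw [hL]; rfl
  convert! MTTNN.isConvexEnvelopeOn_sum_opNuclearNorm Φ using 1
  · ext X
    simp only [MTTNN.mem_spectralBall_iff, MTTNN.spectralNorm_le_one_iff, hΦ, Set.mem_ofPred_eq]
  · funext X
    simp only [MTTNN.multiRankL1, MTTNN.multiRank, Nat.abs_cast,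
      MTTNN.rank_eq_finrank_range_toEuclideanLin]
    exact Finset.sum_congr rfl fun i _ => by rw [hΦ]
  · funext X
    simp only [MTTNN.mtTNN, MTTNN.mntTNN, hΦ, MTTNN.nuclearNorm_eq_opNuclearNorm, MTTNN.mt]
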